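/- **Unique prime factorization in the strong ring.** A finite abstract simplicial complex is a finite set of nonempty finite sets closed under taking nonempty subsets. Its connection graph has the simplices as vertices, two distinct simplices being adjacent if they intersect; the complex is connected if this graph is nonempty and connected. For simplicial complexes, and more generally for finite families $X,Y$ of nonempty finite sets that contain every one-point subset of their base sets, let $X\oplus Y$ be the disjoint union and $X\times Y=\{x\times y : x\in X,\ y\in Y\}$ the Cartesian product (which is in general not a simplicial complex); two families are isomorphic if a bijection of base sets carries one to the other. The isomorphism classes form a commutative semiring under $\oplus,\times$, with zero the empty complex and one the one-point complex $K_1$. The *strong ring* $S$ is the subring generated by the classes of finite abstract simplicial complexes in the Grothendieck ring (the additive group completion) of this semiring. Call an element of $S$ *unsigned* if it is a disjoint union of products of simplicial complexes. An element $G\in S$ is an *additive prime* (a connected element) if $G$ or $-G$ is unsigned, nonzero, and not of the form $A\oplus B$ with $A,B$ both unsigned and nonzero. An element $G\in S$ with $G\neq\pm K_1$ is a *multiplicative prime* if it is not a product $A\times B$ of two elements $A,B\in S$ that are both different from $\pm K_1$. 1. Every additive prime $G$ of $S$ is, up to sign, a product of finitely many multiplicative primes, $G=\pm P_1\times\cdots\times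 P_n$ with $n\ge 0$ (the empty product being $K_1$), and the factors are unique up to order and signs: if also $G=\pm Q_1\times\cdots\times Q_m$ with multiplicative primes $Q_j$, then $m=n$ and, after reordering, $Q_i=\pm P_i$ for all $i$. 2. An element of $S$ is both an additive prime and a multiplicative prime if and only if it is, up to sign, the class of a connected finite simplicial complex with more than one vertex. -/

import Mathlib

/-- A finite family of nonempty finite sets (`cells`) on a finite base set, containing every
one-point set.  Finite abstract simplicial complexes, their disjoint unions and the Cartesian
products of these are of this kind; a product of simplicial complexes is in general not closed
under taking nonempty subsets. -/
structure CellSystem : Type 1 where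
  Vertex : Type
  finite_vertex : Finite Vertex
  cells : Set (Finset Vertex)
  nonempty_of_mem : ∀ x ∈ cells, x.Nonempty
  singleton_mem : ∀ v : Vertex, {v} ∈ cells

namespace CellSystem

/-- Two cell systems are isomorphic if some bijection of the base sets matches the cells. -/
def Iso (X Y : CellSystem) : Prop :=
  ∃ e : X.Vertex ≃ Y.Vertex, ∀ x : Finset X.Vertex, x ∈ X.cells ↔ x.map e.toEmbedding ∈ Y.cells

theorem Iso.refl (X : CellSystem) : Iso X X :=
  ⟨Equiv.refl _, fun x => by simp⟩

theorem Iso.symm {X Y : CellSystem} (h : Iso X Y) : Iso Y X := by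
  obtain ⟨e, he⟩ := h
  refine ⟨e.symm, fun y => ?_⟩
  rw [he, Finset.map_map]
  have : e.symm.toEmbedding.trans e.toEmbedding = Function.Embedding.refl _ := by
    ext; simp
  rw [this, Finset.map_refl]

theorem Iso.trans {X Y Z : CellSystem} (h : Iso X Y) (k : Iso Y Z) : Iso X Z := by
  obtain ⟨e, he⟩ := h
  obtain ⟨f, hf⟩ := k
  refine ⟨e.trans f, fun x => ?_⟩
  rw [he, hf, Finset.map_map]
  rfl

instance setoid : Setoid CellSystem :=
  ⟨Iso, Iso.refl, Iso.symm, Iso.trans⟩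

/-- The one-point complex. -/
def point : CellSystem where
  Vertex := Unit
  finite_vertex := inferInstance
  cells := {{()}}
  nonempty_of_mem := by rintro x rfl; simp
  singleton_mem := fun _ => rfl

/-- The disjoint union. -/
def sum (X Y : CellSystem) : CellSystem where
  Vertex := X.Vertex ⊕ Y.Vertex
  finite_vertex := by
    have := X.finite_vertex
    have := Y.finite_vertex
    infer_instance
  cells := {c | (∃ x ∈ X.cells, c = x.map Function.Embedding.inl) ∨
    (∃ y ∈ Y.cells, c = y.map Function.Embedding.inr)}
  nonempty_of_mem := by
    rintro c (⟨x, hx, rfl⟩ | ⟨y, hy, rfl⟩)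
    · simpa using X.nonempty_of_mem x hx
    · simpa using Y.nonempty_of_mem y hy
  singleton_mem := by
    rintro (v | w)
    · exact Or.inl ⟨{v}, X.singleton_mem v, by simp⟩
    · exact Or.inr ⟨{w}, Y.singleton_mem w, by simp⟩

/-- The Cartesian product: its cells are the set products `x × y` of cells. -/
def prod (X Y : CellSystem) : CellSystem where
  Vertex := X.Vertex × Y.Vertex
  finite_vertex := by
    have := X.finite_vertex
    have := Y.finite_vertex
    infer_instance
  cells := {c | ∃ x ∈ X.cells, ∃ y ∈ Y.cells, c = x ×ˢ y}
  nonempty_of_mem := by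
    rintro c ⟨x, hx, y, hy, rfl⟩
    exact (X.nonempty_of_mem x hx).product (Y.nonempty_of_mem y hy)
  singleton_mem := fun v =>
    ⟨{v.1}, X.singleton_mem _, {v.2}, Y.singleton_mem _, by simp⟩

/-- To check an isomorphism it is enough that the bijection and its inverse preserve cells. -/
theorem Iso.of_maps {X Y : CellSystem} (e : X.Vertex ≃ Y.Vertex)
    (h₁ : ∀ x ∈ X.cells, x.map e.toEmbedding ∈ Y.cells)
    (h₂ : ∀ y ∈ Y.cells, y.map e.symm.toEmbedding ∈ X.cells) : Iso X Y := by
  refine ⟨e, fun x => ⟨h₁ x, fun hx => ?_⟩⟩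
  have := h₂ _ hx
  rw [Finset.map_map] at this
  have h : e.toEmbedding.trans e.symm.toEmbedding = Function.Embedding.refl _ := by
    ext; simp
  rwa [h, Finset.map_refl] at this

theorem prod_congr {X X' Y Y' : CellSystem} (h : Iso X X') (k : Iso Y Y') :
    Iso (X.prod Y) (X'.prod Y') := by
  have key : ∀ {A A' B B' : CellSystem} (e : A.Vertex ≃ A'.Vertex) (f : B.Vertex ≃ B'.Vertex),
      (∀ x, x ∈ A.cells ↔ x.map e.toEmbedding ∈ A'.cells) →
      (∀ y, y ∈ B.cells ↔ y.map f.toEmbedding ∈ B'.cells) →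
      ∀ c ∈ (A.prod B).cells, c.map (e.prodCongr f).toEmbedding ∈ (A'.prod B').cells := by
    rintro A A' B B' e f he hf c ⟨x, hx, y, hy, rfl⟩
    refine ⟨_, (he x).1 hx, _, (hf y).1 hy, ?_⟩
    ext ⟨a, b⟩
    simp only [Finset.mem_map_equiv, Finset.mem_product]
    rfl
  obtain ⟨e, he⟩ := h
  obtain ⟨f, hf⟩ := k
  refine Iso.of_maps (e.prodCongr f) (key e f he hf) (key e.symm f.symm ?_ ?_)
  · intro x
    rw [he, Finset.map_map]
    have : e.symm.toEmbedding.trans e.toEmbedding = Function.Embedding.refl _ := by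
      ext; simp
    rw [this, Finset.map_refl]
  · intro x
    rw [hf, Finset.map_map]
    have : f.symm.toEmbedding.trans f.toEmbedding = Function.Embedding.refl _ := by
      ext; simp
    rw [this, Finset.map_refl]

theorem prod_comm (X Y : CellSystem) : Iso (X.prod Y) (Y.prod X) := by
  have key : ∀ A B : CellSystem, ∀ c ∈ (A.prod B).cells,
      c.map (Equiv.prodComm A.Vertex B.Vertex).toEmbedding ∈ (B.prod A).cells := by
    rintro A B c ⟨x, hx, y, hy, rfl⟩
    refine ⟨y, hy, x, hx, ?_⟩
    ext ⟨a, b⟩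
    simp only [Finset.mem_map_equiv, Finset.mem_product]
    exact and_comm
  exact Iso.of_maps (Equiv.prodComm _ _) (key X Y) (key Y X)

theorem map_prodAssoc {α β γ : Type} (x : Finset α) (y : Finset β) (z : Finset γ) :
    ((x ×ˢ y) ×ˢ z).map (Equiv.prodAssoc α β γ).toEmbedding = x ×ˢ (y ×ˢ z) := by
  ext ⟨a, b, d⟩
  simp only [Finset.mem_map_equiv, Finset.mem_product, Equiv.prodAssoc_symm_apply]
  exact and_assoc

theorem map_prodAssoc_symm {α β γ : Type} (x : Finset α) (y : Finset β) (z : Finset γ) :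
    (x ×ˢ (y ×ˢ z)).map (Equiv.prodAssoc α β γ).symm.toEmbedding = (x ×ˢ y) ×ˢ z := by
  rw [← map_prodAssoc, Finset.map_map]
  have : (Equiv.prodAssoc α β γ).toEmbedding.trans (Equiv.prodAssoc α β γ).symm.toEmbedding =
      Function.Embedding.refl _ := by
    ext p <;> simp
  rw [this, Finset.map_refl]

theorem prod_assoc (X Y Z : CellSystem) : Iso ((X.prod Y).prod Z) (X.prod (Y.prod Z)) := by
  refine Iso.of_maps (Equiv.prodAssoc X.Vertex Y.Vertex Z.Vertex) ?_ ?_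
  · rintro c ⟨_, ⟨x, hx, y, hy, rfl⟩, z, hz, rfl⟩
    exact ⟨x, hx, _, ⟨y, hy, z, hz, rfl⟩, map_prodAssoc x y z⟩
  · rintro c ⟨x, hx, _, ⟨y, hy, z, hz, rfl⟩, rfl⟩
    exact ⟨_, ⟨x, hx, y, hy, rfl⟩, z, hz, map_prodAssoc_symm x y z⟩

theorem map_punitProd {α : Type} (y : Finset α) :
    (({()} : Finset Unit) ×ˢ y).map (Equiv.punitProd α).toEmbedding = y := by
  ext a
  simp only [Finset.mem_map_equiv, Finset.mem_product]
  exact and_iff_right (Finset.mem_singleton_self ())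

theorem map_punitProd_symm {α : Type} (y : Finset α) :
    y.map (Equiv.punitProd α).symm.toEmbedding = ({()} : Finset Unit) ×ˢ y := by
  ext a
  simp only [Finset.mem_map_equiv, Finset.mem_product]
  exact (and_iff_right (Finset.mem_singleton_self ())).symm

theorem point_prod (X : CellSystem) : Iso (point.prod X) X := by
  refine Iso.of_maps (Equiv.punitProd X.Vertex) ?_ ?_
  · rintro c ⟨_, rfl, y, hy, rfl⟩
    exact (map_punitProd y).symm ▸ hy
  · intro y hy
    exact ⟨{()}, rfl, y, hy, map_punitProd_symm y⟩

/-- The cell system of a finite abstract simplicial complex. -/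
def ofComplex {V : Type} [Finite V] (K : AbstractSimplicialComplex V) : CellSystem where
  Vertex := V
  finite_vertex := inferInstance
  cells := K.faces
  nonempty_of_mem := fun _ hx => (K.isRelLowerSet_faces hx).1
  singleton_mem := fun v => K.singleton_mem v

/-- Isomorphism classes of cell systems. -/
def IsoClass : Type 1 := Quotient setoid

/-- The isomorphism class of a cell system. -/
def isoClass (X : CellSystem) : IsoClass := Quotient.mk setoid X

/-- Isomorphism classes form a commutative monoid under the Cartesian product. -/
instance : CommMonoid IsoClass where
  mul := Quotient.map₂ prod fun _ _ h _ _ k => prod_congr h k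
  one := isoClass point
  mul_assoc := by
    rintro ⟨X⟩ ⟨Y⟩ ⟨Z⟩
    exact Quotient.sound (prod_assoc X Y Z)
  mul_comm := by
    rintro ⟨X⟩ ⟨Y⟩
    exact Quotient.sound (prod_comm X Y)
  one_mul := by
    rintro ⟨X⟩
    exact Quotient.sound (point_prod X)
  mul_one := by
    rintro ⟨X⟩
    exact Quotient.sound ((prod_comm X point).trans (point_prod X))

/-- The relations `[X ⊕ Y] = [X] + [Y]`. -/
noncomputable def disjointUnionIdeal : Ideal (MonoidAlgebra ℤ IsoClass) :=
  Ideal.span {r | ∃ X Y : CellSystem, r = MonoidAlgebra.of ℤ IsoClass (isoClass (X.sum Y)) -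
    (MonoidAlgebra.of ℤ IsoClass (isoClass X) + MonoidAlgebra.of ℤ IsoClass (isoClass Y))}

/-- The Grothendieck ring of cell systems: the abelian group generated by isomorphism classes
with `[X ⊕ Y] = [X] + [Y]`, that is, the group completion of the monoid of isomorphism classes
under disjoint union, with the multiplication induced by the Cartesian product. -/
abbrev GrothendieckRing : Type 1 := MonoidAlgebra ℤ IsoClass ⧸ disjointUnionIdeal

/-- The element of the Grothendieck ring represented by a cell system. -/
noncomputable def toRing (X : CellSystem) : GrothendieckRing :=
  Ideal.Quotient.mk disjointUnionIdeal (MonoidAlgebra.of ℤ IsoClass (isoClass X))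

end CellSystem

/-- The strong ring: the subring generated by the finite abstract simplicial complexes. -/
noncomputable def strongRing : Subring CellSystem.GrothendieckRing :=
  Subring.closure {g | ∃ (V : Type) (_ : Finite V) (K : AbstractSimplicialComplex V),
    g = CellSystem.toRing (CellSystem.ofComplex K)}

/-- A finite abstract simplicial complex as an element of the strong ring. -/
noncomputable def complexClass {V : Type} [Finite V] (K : AbstractSimplicialComplex V) :
    strongRing :=
  ⟨CellSystem.toRing (CellSystem.ofComplex K), Subring.subset_closure ⟨V, inferInstance, K, rfl⟩⟩

/-- The unsigned elements of the strong ring: the disjoint unions of products of simplicial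
complexes. -/
noncomputable def unsignedElements : Subsemiring strongRing :=
  Subsemiring.closure {g | ∃ (V : Type) (_ : Finite V) (K : AbstractSimplicialComplex V),
    g = complexClass K}

/-- `G` is unsigned, nonzero and not a disjoint union `A ⊕ B` with `A` and `B` both nonempty. -/
def IsUnsignedAdditivePrime (G : strongRing) : Prop :=
  G ∈ unsignedElements ∧ G ≠ 0 ∧
    ∀ A ∈ unsignedElements, ∀ B ∈ unsignedElements, G = A + B → A = 0 ∨ B = 0

/-- Additive primes: the connected elements, each of which may carry either sign. -/
def IsAdditivePrime (G : strongRing) : Prop :=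
  IsUnsignedAdditivePrime G ∨ IsUnsignedAdditivePrime (-G)

/-- Multiplicative primes: elements other than the one-point complex `1` (up to sign) that are
not a product of two elements of the strong ring which both differ from `1` (up to sign). -/
def IsMultiplicativePrime (G : strongRing) : Prop :=
  ¬ (G = 1 ∨ G = -1) ∧ ∀ A B : strongRing, G = A * B → (A = 1 ∨ A = -1) ∨ (B = 1 ∨ B = -1)

/-- The connection graph of a simplicial complex: the vertices are the simplices, and two distinct
simplices are adjacent if they intersect. -/
def connectionGraph {V : Type} (K : AbstractSimplicialComplex V) : SimpleGraph K.faces where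
  Adj x y := x ≠ y ∧ ¬ Disjoint (x : Finset V) (y : Finset V)
  symm := ⟨fun _ _ h => ⟨h.1.symm, fun hd => h.2 hd.symm⟩⟩
  loopless := ⟨fun _ h => h.1 rfl⟩

/-! The strong ring is a polynomial ring over ℤ whose variables are the isomorphism classes of
connected simplicial complexes with more than one vertex (`strongRingEquiv`). It is therefore
factorial with units ±1, which gives the unique factorization. Unsigned elements correspond to
polynomials with nonnegative coefficients, so additive primes are the monomials up to sign; an
irreducible monomial is a variable.

The variables generate because a simplicial complex is the disjoint union of its connected
components, and the one-point complex is 1 (`exists_poly_of_isComplex`).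

They are algebraically independent for two reasons. For connected `p`, the number of components
isomorphic to `p` is additive under disjoint union and descends to the Grothendieck ring
(`countHom_eq_zero`). Monomials are represented by connected systems, and distinct monomials by
non-isomorphic ones (`prod_primeClass_injective`), so this functional reads off a single
coefficient.

The combinatorial core is that an isomorphism of products matches the factors. Two-point cells of a
product are edges in one coordinate direction, and whether two edges at a common vertex have the
same direction is visible from the cells alone (`parallel_iff`). By connectedness an isomorphism
thus sends each layer of a factor into one layer (`exists_layer`); the inverse does the same, and
corresponding layers are isomorphic. -/

namespace CellSystem

/-! ### Saturated sets, connectedness and decomposition -/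

/-- A set of vertices is saturated if it contains each cell that it meets. -/
def Saturated (X : CellSystem) (C : Set X.Vertex) : Prop :=
  ∀ c ∈ X.cells, ∀ a ∈ c, ∀ b ∈ c, a ∈ C → b ∈ C

/-- A cell system is connected if it is nonempty and has no proper nonempty saturated set. -/
def Conn (X : CellSystem) : Prop :=
  Nonempty X.Vertex ∧ ∀ C : Set X.Vertex, X.Saturated C → C.Nonempty → C = Set.univ

theorem Saturated.compl {X : CellSystem} {C : Set X.Vertex} (h : X.Saturated C) :
    X.Saturated Cᶜ :=
  fun c hc a ha b hb hac hbc => hac (h c hc b hb a ha hbc)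

theorem Saturated.preimage {X Y : CellSystem} (f : X.Vertex ↪ Y.Vertex)
    (hf : ∀ c ∈ X.cells, c.map f ∈ Y.cells) {C : Set Y.Vertex} (h : Y.Saturated C) :
    X.Saturated (f ⁻¹' C) :=
  fun c hc a ha b hb hac => h _ (hf c hc) (f a) (Finset.mem_map_of_mem f ha) (f b)
    (Finset.mem_map_of_mem f hb) hac

theorem Conn.of_iso {X Y : CellSystem} (h : Conn X) (k : Iso X Y) : Conn Y := by
  obtain ⟨e, he⟩ := k
  refine ⟨h.1.map e, fun C hC hne => ?_⟩
  have := h.2 _ (hC.preimage e.toEmbedding fun c hc => (he c).1 hc)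
    (by obtain ⟨y, hy⟩ := hne; exact ⟨e.symm y, by simpa using hy⟩)
  ext y
  have hy : e.symm y ∈ e.toEmbedding ⁻¹' C := this ▸ Set.mem_univ _
  simpa using hy

/-- The cell system induced on a set of vertices. -/
def restrict (X : CellSystem) (C : Set X.Vertex) : CellSystem where
  Vertex := C
  finite_vertex := by
    have := X.finite_vertex
    infer_instance
  cells := {c | c.map (Function.Embedding.subtype (· ∈ C)) ∈ X.cells}
  nonempty_of_mem := fun c hc => by simpa using X.nonempty_of_mem _ hc
  singleton_mem := fun v => by simpa using X.singleton_mem v.1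

theorem restrict_image_iso {X Y : CellSystem} (f : X.Vertex ↪ Y.Vertex)
    (hf : ∀ c, c ∈ X.cells ↔ c.map f ∈ Y.cells) (C : Set X.Vertex) :
    Iso (X.restrict C) (Y.restrict (f '' C)) := by
  refine ⟨Equiv.Set.image f C f.injective, fun x => ?_⟩
  refine (hf _).trans (iff_of_eq (congrArg (· ∈ Y.cells) ?_))
  exact (Finset.map_map _ _ x).trans (Finset.map_map
    (Equiv.Set.image f C f.injective).toEmbedding (Function.Embedding.subtype (· ∈ f '' C)) x).symm

theorem restrict_univ_iso (X : CellSystem) : Iso (X.restrict Set.univ) X :=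
  ⟨Equiv.Set.univ _, fun _ => Iff.rfl⟩

/-- To check an isomorphism it is enough that the bijection matches cells in both directions. -/
theorem Iso.of_exists {X Y : CellSystem} (e : X.Vertex ≃ Y.Vertex)
    (h₁ : ∀ x ∈ X.cells, ∃ y ∈ Y.cells, ∀ v, v ∈ x ↔ e v ∈ y)
    (h₂ : ∀ y ∈ Y.cells, ∃ x ∈ X.cells, ∀ v, v ∈ x ↔ e v ∈ y) : Iso X Y := by
  refine Iso.of_maps e (fun x hx => ?_) (fun y hy => ?_)
  · obtain ⟨y, hy, h⟩ := h₁ x hx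
    convert hy
    ext v
    rw [Finset.mem_map_equiv, h, e.apply_symm_apply]
  · obtain ⟨x, hx, h⟩ := h₂ y hy
    convert hx
    ext v
    rw [Finset.mem_map_equiv, h, e.symm_symm]

/-- No cell straddles a saturated set and its complement, since a cell that meets either one is
contained in it. -/
theorem iso_sum_restrict {X : CellSystem} {C : Set X.Vertex} (h : X.Saturated C) :
    Iso ((X.restrict C).sum (X.restrict Cᶜ)) X := by
  classical
  have key : ∀ D : Set X.Vertex, X.Saturated D → ∀ y ∈ X.cells, ∀ a ∈ y, a ∈ D →
      ∃ z ∈ (X.restrict D).cells, ∀ v : D, v ∈ z ↔ v.1 ∈ y := by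
    intro D hD y hy a ha haD
    refine ⟨y.subtype (· ∈ D), ?_, fun v => Finset.mem_subtype⟩
    change Finset.map _ (y.subtype (· ∈ D)) ∈ X.cells
    rw [Finset.subtype_map, Finset.filter_true_of_mem fun b hb => hD y hy a ha b hb haD]
    exact hy
  refine Iso.of_exists (Equiv.Set.sumCompl C) ?_ ?_
  · rintro c (⟨x, hx, rfl⟩ | ⟨x, hx, rfl⟩)
    · refine ⟨_, hx, ?_⟩
      rintro (v | v)
      · exact (Finset.mem_map' _).trans (Finset.mem_map' _).symm
      · refine iff_of_false (fun hv => ?_) (fun hv => ?_)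
        · obtain ⟨w, _, hw⟩ := Finset.mem_map.1 hv
          cases hw
        · obtain ⟨w, _, hw⟩ := Finset.mem_map.1 hv
          have hw' : w.1 = v.1 := hw
          exact v.2 (hw' ▸ w.2)
    · refine ⟨_, hx, ?_⟩
      rintro (v | v)
      · refine iff_of_false (fun hv => ?_) (fun hv => ?_)
        · obtain ⟨w, _, hw⟩ := Finset.mem_map.1 hv
          cases hw
        · obtain ⟨w, _, hw⟩ := Finset.mem_map.1 hv
          have hw' : w.1 = v.1 := hw
          exact w.2 (hw' ▸ v.2)
      · exact (Finset.mem_map' _).trans (Finset.mem_map' _).symm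
  · intro y hy
    obtain ⟨a, ha⟩ := X.nonempty_of_mem y hy
    by_cases haC : a ∈ C
    · obtain ⟨z, hz, hzy⟩ := key C h y hy a ha haC
      refine ⟨_, Or.inl ⟨z, hz, rfl⟩, ?_⟩
      rintro (v | v)
      · exact (Finset.mem_map' _).trans (hzy v)
      · refine iff_of_false (fun hv => ?_) (fun hv => v.2 (h y hy a ha _ hv haC))
        obtain ⟨w, _, hw⟩ := Finset.mem_map.1 hv
        cases hw
    · obtain ⟨z, hz, hzy⟩ := key Cᶜ h.compl y hy a ha haC
      refine ⟨_, Or.inr ⟨z, hz, rfl⟩, ?_⟩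
      rintro (v | v)
      · refine iff_of_false (fun hv => ?_) (fun hv => h.compl y hy a ha _ hv haC v.2)
        obtain ⟨w, _, hw⟩ := Finset.mem_map.1 hv
        cases hw
      · exact (Finset.mem_map' _).trans (hzy v)

/-! ### Counting connected components -/

/-- The number of saturated vertex sets whose induced cell system is isomorphic to `p`; for
connected `p` these are the connected components isomorphic to `p`. -/
noncomputable def count (p X : CellSystem) : ℕ :=
  {C : Set X.Vertex | X.Saturated C ∧ Iso (X.restrict C) p}.ncard

theorem count_le_of_iso (p : CellSystem) {X Y : CellSystem} (h : Iso X Y) :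
    count p X ≤ count p Y := by
  obtain ⟨e, he⟩ := h
  have := Y.finite_vertex
  refine Set.ncard_le_ncard_of_injOn (fun C => e.toEmbedding '' C) ?_ ?_ (Set.toFinite _)
  · rintro C ⟨hC, hp⟩
    refine ⟨?_, (restrict_image_iso e.toEmbedding he C).symm.trans hp⟩
    rintro c hc _ ha b hb ⟨a, haC, rfl⟩
    have hs : c.map e.symm.toEmbedding ∈ X.cells := by
      rw [he, Finset.map_map]
      convert hc
      convert Finset.map_refl
      ext; simp
    refine ⟨e.symm b, hC _ hs a ?_ _ ?_ haC, by simp⟩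
    · simpa using ha
    · simpa using hb
  · exact (Set.image_injective.2 e.injective).injOn

theorem count_congr (p : CellSystem) {X Y : CellSystem} (h : Iso X Y) :
    count p X = count p Y :=
  (count_le_of_iso p h).antisymm (count_le_of_iso p h.symm)

theorem nonempty_of_restrict_iso {p X : CellSystem} (hp : Conn p) {C : Set X.Vertex}
    (h : Iso (X.restrict C) p) : C.Nonempty := by
  obtain ⟨e, _⟩ := h
  obtain ⟨v⟩ := hp.1
  exact ⟨_, (e.symm v).2⟩

theorem map_inl_mem_sum {X Y : CellSystem} (c : Finset X.Vertex) :
    c ∈ X.cells ↔ c.map Function.Embedding.inl ∈ (X.sum Y).cells := by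
  refine ⟨fun hc => Or.inl ⟨c, hc, rfl⟩, ?_⟩
  rintro (⟨x, hx, h⟩ | ⟨y, hy, h⟩)
  · rwa [Finset.map_injective _ h]
  · obtain ⟨b, hb⟩ := Y.nonempty_of_mem y hy
    have := h.symm ▸ Finset.mem_map_of_mem Function.Embedding.inr hb
    simp at this

theorem map_inr_mem_sum {X Y : CellSystem} (c : Finset Y.Vertex) :
    c ∈ Y.cells ↔ c.map Function.Embedding.inr ∈ (X.sum Y).cells := by
  refine ⟨fun hc => Or.inr ⟨c, hc, rfl⟩, ?_⟩
  rintro (⟨y, hy, h⟩ | ⟨x, hx, h⟩)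
  · obtain ⟨b, hb⟩ := X.nonempty_of_mem y hy
    have := h.symm ▸ Finset.mem_map_of_mem Function.Embedding.inl hb
    simp at this
  · rwa [Finset.map_injective _ h]

/-- Each summand is saturated in the sum, so a connected saturated set lies in exactly one of them.
-/
theorem count_sum {p : CellSystem} (hp : Conn p) (X Y : CellSystem) :
    count p (X.sum Y) = count p X + count p Y := by
  have := X.finite_vertex
  have := Y.finite_vertex
  let i : X.Vertex ↪ (X.sum Y).Vertex := Function.Embedding.inl
  let j : Y.Vertex ↪ (X.sum Y).Vertex := Function.Embedding.inr
  have hi : ∀ c, c ∈ X.cells ↔ c.map i ∈ (X.sum Y).cells := map_inl_mem_sum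
  have hj : ∀ c, c ∈ Y.cells ↔ c.map j ∈ (X.sum Y).cells := map_inr_mem_sum
  have hset : {C : Set (X.sum Y).Vertex | (X.sum Y).Saturated C ∧ Iso ((X.sum Y).restrict C) p} =
      (Set.image i) '' {C : Set X.Vertex | X.Saturated C ∧ Iso (X.restrict C) p} ∪
      (Set.image j) '' {C : Set Y.Vertex | Y.Saturated C ∧ Iso (Y.restrict C) p} := by
    ext C
    constructor
    · rintro ⟨hC, hiso⟩
      have hconn : Conn ((X.sum Y).restrict C) := hp.of_iso hiso.symm
      have hD : ((X.sum Y).restrict C).Saturated {v | v.1 ∈ Set.range i} := by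
        intro c hc a ha b hb hai
        obtain ⟨a', ha'⟩ := hai
        have ha2 := Finset.mem_map_of_mem (Function.Embedding.subtype (· ∈ C)) ha
        have hb2 := Finset.mem_map_of_mem (Function.Embedding.subtype (· ∈ C)) hb
        rcases hc with ⟨x, hx, h⟩ | ⟨y, hy, h⟩
        · rw [h] at hb2
          obtain ⟨b', _, hb'⟩ := Finset.mem_map.1 hb2
          exact ⟨b', hb'⟩
        · rw [h] at ha2
          obtain ⟨b', _, hb'⟩ := Finset.mem_map.1 ha2
          exact absurd (hb'.trans ha'.symm) Sum.inr_ne_inl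
      by_cases hne : ({v : C | v.1 ∈ Set.range i} : Set C).Nonempty
      · have huniv := hconn.2 _ hD hne
        have hCi : C = i '' (i ⁻¹' C) := by
          rw [Set.image_preimage_eq_inter_range]
          refine (Set.inter_eq_left.2 fun v hv => ?_).symm
          have : (⟨v, hv⟩ : C) ∈ {v : C | v.1 ∈ Set.range i} := huniv ▸ Set.mem_univ _
          exact this
        refine Or.inl ⟨i ⁻¹' C, ⟨hC.preimage i fun c => (hi c).1, ?_⟩, hCi.symm⟩
        refine (restrict_image_iso i hi _).trans ?_
        rwa [← hCi]
      · have hCj : C = j '' (j ⁻¹' C) := by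
          rw [Set.image_preimage_eq_inter_range]
          refine (Set.inter_eq_left.2 fun v hv => ?_).symm
          rcases v with v | v
          · exact absurd ⟨⟨_, hv⟩, v, rfl⟩ hne
          · exact ⟨v, rfl⟩
        refine Or.inr ⟨j ⁻¹' C, ⟨hC.preimage j fun c => (hj c).1, ?_⟩, hCj.symm⟩
        refine (restrict_image_iso j hj _).trans ?_
        rwa [← hCj]
    · rintro (⟨C, ⟨hC, hiso⟩, rfl⟩ | ⟨C, ⟨hC, hiso⟩, rfl⟩)
      · refine ⟨?_, (restrict_image_iso i hi C).symm.trans hiso⟩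
        rintro c (⟨x, hx, rfl⟩ | ⟨y, hy, rfl⟩) _ ha b hb ⟨a, haC, rfl⟩
        · obtain ⟨b', hb', rfl⟩ := Finset.mem_map.1 hb
          exact ⟨b', hC x hx a ((Finset.mem_map' _).1 ha) b' hb' haC, rfl⟩
        · obtain ⟨a', _, ha'⟩ := Finset.mem_map.1 ha
          exact absurd ha' Sum.inr_ne_inl
      · refine ⟨?_, (restrict_image_iso j hj C).symm.trans hiso⟩
        rintro c (⟨x, hx, rfl⟩ | ⟨y, hy, rfl⟩) _ ha b hb ⟨a, haC, rfl⟩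
        · obtain ⟨a', _, ha'⟩ := Finset.mem_map.1 ha
          exact absurd ha' Sum.inl_ne_inr
        · obtain ⟨b', hb', rfl⟩ := Finset.mem_map.1 hb
          exact ⟨b', hC y hy a ((Finset.mem_map' _).1 ha) b' hb' haC, rfl⟩
  -- Connectedness of `p` excludes the empty set, which would otherwise belong to both images.
  have hdisj : Disjoint
      ((Set.image i) '' {C : Set X.Vertex | X.Saturated C ∧ Iso (X.restrict C) p})
      ((Set.image j) '' {C : Set Y.Vertex | Y.Saturated C ∧ Iso (Y.restrict C) p}) := by
    rw [Set.disjoint_left]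
    rintro _ ⟨C, ⟨_, hiso⟩, rfl⟩ ⟨D, _, hDC⟩
    obtain ⟨v, hv⟩ := nonempty_of_restrict_iso hp hiso
    have : i v ∈ j '' D := by
      have h : j '' D = i '' C := hDC
      rw [h]
      exact ⟨v, hv, rfl⟩
    obtain ⟨w, _, hw⟩ := this
    exact absurd hw Sum.inr_ne_inl
  rw [count, hset, Set.ncard_union_eq hdisj ((Set.toFinite _).image _) ((Set.toFinite _).image _),
    Set.ncard_image_of_injective _ (Set.image_injective.2 i.injective),
    Set.ncard_image_of_injective _ (Set.image_injective.2 j.injective)]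
  rfl

theorem count_eq_one {p q : CellSystem} (hq : Conn q) (h : Iso q p) : count p q = 1 := by
  rw [count, Set.ncard_eq_one]
  refine ⟨Set.univ, Set.eq_singleton_iff_unique_mem.2
    ⟨⟨fun _ _ _ _ _ _ _ => Set.mem_univ _, q.restrict_univ_iso.trans h⟩, ?_⟩⟩
  rintro C ⟨hC, hiso⟩
  exact hq.2 C hC (nonempty_of_restrict_iso (hq.of_iso h) hiso)

theorem count_eq_zero {p q : CellSystem} (hp : Conn p) (hq : Conn q) (h : ¬ Iso q p) :
    count p q = 0 := by
  have := q.finite_vertex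
  rw [count, Set.ncard_eq_zero, Set.eq_empty_iff_forall_notMem]
  rintro C ⟨hC, hiso⟩
  obtain rfl := hq.2 C hC (nonempty_of_restrict_iso hp hiso)
  exact h (q.restrict_univ_iso.symm.trans hiso)

/-! ### Connectedness of products and distributivity -/

theorem conn_point : Conn point :=
  ⟨⟨()⟩, fun _ _ ⟨a, ha⟩ => Set.eq_univ_of_forall fun b => Subsingleton.elim (α := Unit) a b ▸ ha⟩

/-- Singletons are cells, so every slice parallel to a factor inherits the cells of that factor. Any
vertex is reached by one horizontal and one vertical slice. -/
theorem Conn.prod {X Y : CellSystem} (hX : Conn X) (hY : Conn Y) : Conn (X.prod Y) := by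
  refine ⟨⟨(hX.1.some, hY.1.some)⟩, fun C hC => ?_⟩
  rintro ⟨⟨a, b⟩, hab⟩
  have h1 : {x | ((x, b) : X.Vertex × Y.Vertex) ∈ C} = Set.univ := by
    refine hX.2 _ (fun c hc u hu v hv huC => ?_) ⟨a, hab⟩
    exact hC _ ⟨c, hc, {b}, Y.singleton_mem b, rfl⟩ (u, b)
      (Finset.mk_mem_product hu (Finset.mem_singleton_self b)) (v, b)
      (Finset.mk_mem_product hv (Finset.mem_singleton_self b)) huC
  refine Set.eq_univ_of_forall fun ⟨a', b'⟩ => ?_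
  have h2 : {y | ((a', y) : X.Vertex × Y.Vertex) ∈ C} = Set.univ := by
    refine hY.2 _ (fun c hc u hu v hv huC => ?_)
      ⟨b, (h1 ▸ Set.mem_univ a' : a' ∈ {x | ((x, b) : X.Vertex × Y.Vertex) ∈ C})⟩
    exact hC _ ⟨{a'}, X.singleton_mem a', c, hc, rfl⟩ (a', u)
      (Finset.mk_mem_product (Finset.mem_singleton_self a') hu) (a', v)
      (Finset.mk_mem_product (Finset.mem_singleton_self a') hv) huC
  exact (h2 ▸ Set.mem_univ b' : b' ∈ {y | ((a', y) : X.Vertex × Y.Vertex) ∈ C})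

theorem mem_map_inl_product_iff {α β γ : Type} (x : Finset α) (z : Finset γ)
    (v : (α ⊕ β) × γ) : v ∈ x.map Function.Embedding.inl ×ˢ z ↔
      Equiv.sumProdDistrib α β γ v ∈ (x ×ˢ z).map Function.Embedding.inl := by
  obtain ⟨a | b, c⟩ := v <;> simp [Finset.mem_product]

theorem mem_map_inr_product_iff {α β γ : Type} (y : Finset β) (z : Finset γ)
    (v : (α ⊕ β) × γ) : v ∈ y.map Function.Embedding.inr ×ˢ z ↔
      Equiv.sumProdDistrib α β γ v ∈ (y ×ˢ z).map Function.Embedding.inr := by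
  obtain ⟨a | b, c⟩ := v <;> simp [Finset.mem_product]

theorem sum_prod (X Y Z : CellSystem) :
    Iso ((X.sum Y).prod Z) ((X.prod Z).sum (Y.prod Z)) := by
  refine Iso.of_exists (Equiv.sumProdDistrib X.Vertex Y.Vertex Z.Vertex) ?_ ?_
  · rintro c ⟨_, ⟨x, hx, rfl⟩ | ⟨y, hy, rfl⟩, z, hz, rfl⟩
    · exact ⟨_, Or.inl ⟨_, ⟨x, hx, z, hz, rfl⟩, rfl⟩, mem_map_inl_product_iff x z⟩
    · exact ⟨_, Or.inr ⟨_, ⟨y, hy, z, hz, rfl⟩, rfl⟩, mem_map_inr_product_iff y z⟩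
  · rintro c (⟨_, ⟨x, hx, z, hz, rfl⟩, rfl⟩ | ⟨_, ⟨x, hx, z, hz, rfl⟩, rfl⟩)
    · exact ⟨_, ⟨_, Or.inl ⟨x, hx, rfl⟩, z, hz, rfl⟩, mem_map_inl_product_iff x z⟩
    · exact ⟨_, ⟨_, Or.inr ⟨x, hx, rfl⟩, z, hz, rfl⟩, mem_map_inr_product_iff x z⟩

/-! ### Simplicial complexes and the connection graph -/

/-- A cell system is a simplicial complex if its cells are closed under nonempty subsets. -/
def IsComplex (X : CellSystem) : Prop :=
  ∀ x ∈ X.cells, ∀ y ⊆ x, y.Nonempty → y ∈ X.cells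

theorem isComplex_ofComplex {V : Type} [Finite V] (K : AbstractSimplicialComplex V) :
    (ofComplex K).IsComplex :=
  fun _ hx _ hyx hy => (K.isRelLowerSet_faces hx).2 hyx hy

/-- The simplicial complex whose faces are the cells. -/
def IsComplex.toComplex {X : CellSystem} (h : X.IsComplex) :
    AbstractSimplicialComplex X.Vertex where
  faces := X.cells
  isRelLowerSet_faces := fun x hx => ⟨X.nonempty_of_mem x hx, fun y hyx hy => h x hx y hyx hy⟩
  singleton_mem := X.singleton_mem

theorem IsComplex.restrict {X : CellSystem} (h : X.IsComplex) (C : Set X.Vertex) :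
    (X.restrict C).IsComplex :=
  fun _ hx _ hyx hy => h _ hx _ (Finset.map_subset_map.2 hyx) (Finset.map_nonempty.2 hy)

/-- Singleton simplices translate between vertices and simplices: a simplex meets the singleton of
each of its vertices, and walks in the graph propagate a saturated set through common vertices. -/
theorem conn_ofComplex_iff {V : Type} [Finite V] (K : AbstractSimplicialComplex V) :
    Conn (ofComplex K) ↔ (connectionGraph K).Connected := by
  have hadj : ∀ x y : K.faces, ¬ Disjoint (x : Finset V) (y : Finset V) →
      (connectionGraph K).Reachable x y := by
    intro x y h
    by_cases hxy : x = y
    · exact hxy ▸ SimpleGraph.Reachable.refl _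
    · exact SimpleGraph.Adj.reachable ⟨hxy, h⟩
  constructor
  · intro h
    obtain ⟨v⟩ : Nonempty V := h.1
    let s : V → K.faces := fun v => ⟨{v}, K.singleton_mem v⟩
    have hs : ∀ (x : K.faces) (a : V), a ∈ (x : Finset V) →
        (connectionGraph K).Reachable (s a) x := fun x a ha => by
      refine hadj _ _ ?_
      simpa [s] using ha
    have hC := h.2 {w | (connectionGraph K).Reachable (s v) (s w)}
      (fun c hc a ha b hb hva => (hva.trans (hs ⟨c, hc⟩ a ha)).trans (hs ⟨c, hc⟩ b hb).symm)
      ⟨v, SimpleGraph.Reachable.refl _⟩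
    have key : ∀ x, (connectionGraph K).Reachable (s v) x := by
      intro x
      obtain ⟨a, ha⟩ := (K.isRelLowerSet_faces x.2).1
      have hva : a ∈ {w | (connectionGraph K).Reachable (s v) (s w)} := by
        exact hC.ge (Set.mem_univ a)
      exact hva.trans (hs x a ha)
    have : Nonempty K.faces := ⟨s v⟩
    exact ⟨fun x y => (key x).symm.trans (key y)⟩
  · intro h
    obtain ⟨x⟩ := h.nonempty
    obtain ⟨v, hv⟩ := (K.isRelLowerSet_faces x.2).1
    refine ⟨⟨v⟩, fun C hC => ?_⟩
    rintro ⟨a, ha⟩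
    refine Set.eq_univ_of_forall fun b => ?_
    have key {x y : K.faces} (hxy : (connectionGraph K).Reachable x y) :
        (∀ a ∈ (x : Finset V), a ∈ C) → ∀ a ∈ (y : Finset V), a ∈ C := by
      obtain ⟨w⟩ := hxy
      induction w with
      | nil => exact id
      | cons hadj _ ih =>
        intro hx
        obtain ⟨d, hd1, hd2⟩ := Finset.not_disjoint_iff.1 hadj.2
        exact ih fun c hc => hC _ (Subtype.prop _) d hd2 c hc (hx d hd1)
    have hr := h.preconnected ⟨{a}, K.singleton_mem a⟩ ⟨{b}, K.singleton_mem b⟩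
    refine key hr ?_ b (Finset.mem_singleton_self b)
    intro a' ha'
    rwa [Finset.mem_singleton.1 ha']

/-! ### Edges and the parallelism relation -/

/-- The two points form a cell. -/
def Edge (X : CellSystem) (a b : X.Vertex) : Prop :=
  a ≠ b ∧ ∃ c ∈ X.cells, ∀ v, v ∈ c ↔ v = a ∨ v = b

theorem Edge.symm {X : CellSystem} {a b : X.Vertex} (h : X.Edge a b) : X.Edge b a :=
  ⟨h.1.symm, h.2.imp fun _ hc => ⟨hc.1, fun v => (hc.2 v).trans or_comm⟩⟩

/-- The local relation between edges `ab` and `ac` that singles out, in a product of simplicial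
complexes, the pairs of edges in the direction of the same factor. -/
def Parallel (X : CellSystem) (a b c : X.Vertex) : Prop :=
  b = c ∨ X.Edge b c ∨ ∀ d ∈ X.cells, ¬ (a ∈ d ∧ b ∈ d ∧ c ∈ d)

theorem IsComplex.edge {X : CellSystem} (h : X.IsComplex) {c : Finset X.Vertex}
    (hc : c ∈ X.cells) {a b : X.Vertex} (ha : a ∈ c) (hb : b ∈ c) (hab : a ≠ b) :
    X.Edge a b := by
  classical
  refine ⟨hab, {a, b}, h c hc _ ?_ ⟨a, by simp⟩, by simp⟩
  intro v hv
  rcases Finset.mem_insert.1 hv with rfl | hv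
  · exact ha
  · rwa [Finset.mem_singleton.1 hv]

/-- In a connected complex, a nonempty set of vertices closed under edges is everything. -/
theorem IsComplex.eq_univ {X : CellSystem} (h : X.IsComplex) (hX : Conn X) {C : Set X.Vertex}
    (hC : ∀ a b, X.Edge a b → a ∈ C → b ∈ C) (hne : C.Nonempty) : C = Set.univ := by
  refine hX.2 C (fun c hc a ha b hb haC => ?_) hne
  by_cases hab : a = b
  · exact hab ▸ haC
  · exact hC a b (h.edge hc ha hb hab) haC

theorem IsComplex.exists_edge {X : CellSystem} (h : X.IsComplex) (hX : Conn X)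
    [Nontrivial X.Vertex] (a : X.Vertex) : ∃ b, X.Edge a b := by
  by_contra! hcon
  obtain ⟨b, hb⟩ := exists_ne a
  have := h.eq_univ hX (C := {a}) (fun u v huv hu => ?_) ⟨a, rfl⟩
  · exact hb (this ▸ Set.mem_univ b : b ∈ ({a} : Set X.Vertex))
  · obtain rfl : u = a := hu
    exact absurd huv (hcon v)

/-! ### Finite products and the directions of their edges -/

/-- The product of a finite family of cell systems. -/
def pi {ι : Type} [Finite ι] (P : ι → CellSystem) : CellSystem where
  Vertex := ∀ i, (P i).Vertex
  finite_vertex := by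
    have := fun i => (P i).finite_vertex
    infer_instance
  cells := {c | ∃ x : ∀ i, Finset (P i).Vertex, (∀ i, x i ∈ (P i).cells) ∧
    ∀ v, v ∈ c ↔ ∀ i, v i ∈ x i}
  nonempty_of_mem := by
    rintro c ⟨x, hx, h⟩
    choose v hv using fun i => (P i).nonempty_of_mem (x i) (hx i)
    exact ⟨v, (h v).2 hv⟩
  singleton_mem := fun v => ⟨fun i => {v i}, fun i => (P i).singleton_mem _, fun w => by
    simp only [Finset.mem_singleton]
    exact funext_iff⟩

section pi

variable {ι : Type} {P : ι → CellSystem}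

theorem exists_cell [Finite ι] (x : ∀ i, Finset (P i).Vertex) (hx : ∀ i, x i ∈ (P i).cells) :
    ∃ c ∈ (pi P).cells, ∀ v : ∀ i, (P i).Vertex, v ∈ c ↔ ∀ i, v i ∈ x i := by
  classical
  have := fun i => (P i).finite_vertex
  have := Fintype.ofFinite (∀ i, (P i).Vertex)
  exact ⟨(Finset.univ : Finset (∀ i, (P i).Vertex)).filter fun v => ∀ i, v i ∈ x i,
    ⟨x, hx, fun v => Finset.mem_filter.trans (and_iff_right (Finset.mem_univ v))⟩,
    fun v => Finset.mem_filter.trans (and_iff_right (Finset.mem_univ v))⟩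

/-- The points `a` and `b` of a product differ in the coordinate `i` only, and by an edge. -/
def EdgeAt (P : ι → CellSystem) (i : ι) (a b : ∀ i, (P i).Vertex) : Prop :=
  (∀ k, k ≠ i → a k = b k) ∧ (P i).Edge (a i) (b i)

theorem EdgeAt.symm {i : ι} {a b : ∀ i, (P i).Vertex} (h : EdgeAt P i a b) : EdgeAt P i b a :=
  ⟨fun k hk => (h.1 k hk).symm, h.2.symm⟩

theorem EdgeAt.unique {i j : ι} {a b : ∀ i, (P i).Vertex} (h : EdgeAt P i a b)
    (k : EdgeAt P j a b) : i = j := by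
  by_contra hij
  exact h.2.1 (k.1 i hij)

theorem EdgeAt.edge [Finite ι] {i : ι} {a b : ∀ i, (P i).Vertex} (h : EdgeAt P i a b) :
    (pi P).Edge a b := by
  classical
  obtain ⟨hk, hne, d, hd, hdv⟩ := h
  obtain ⟨c, hc, hcv⟩ := exists_cell (Function.update (fun k => {a k}) i d) (fun k => by
    by_cases hki : k = i
    · subst hki; simpa using hd
    · simpa [hki] using (P k).singleton_mem (a k))
  refine ⟨fun hab => hne (congrFun hab i), c, hc, fun v => (hcv v).trans ⟨fun hv => ?_, ?_⟩⟩
  · have hoff : ∀ k, k ≠ i → v k = a k := fun k hki => by simpa [hki] using hv k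
    have hi := hv i
    rw [Function.update_self, hdv] at hi
    refine hi.imp (fun hi => funext fun k => ?_) (fun hi => funext fun k => ?_)
    · by_cases hki : k = i
      · subst hki; exact hi
      · exact hoff k hki
    · by_cases hki : k = i
      · subst hki; exact hi
      · exact (hoff k hki).trans (hk k hki)
  · rintro (rfl | rfl) k
    · by_cases hki : k = i
      · subst hki; simp [hdv]
      · simp [hki]
    · by_cases hki : k = i
      · subst hki; simp [hdv]
      · simp [hki, hk k hki]

/-- A two-point cell is a box. If `a` and `b` differ at `i`, changing only that coordinate of `a` to
`b i` stays in the box, so it must give `b`; the remaining coordinates agree. -/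
theorem Edge.exists_edgeAt [Finite ι] {a b : ∀ i, (P i).Vertex} (h : (pi P).Edge a b) :
    ∃ i, EdgeAt P i a b := by
  classical
  obtain ⟨hne, c, ⟨x, hx, hcx⟩, hc⟩ := h
  have hmem : ∀ v : ∀ i, (P i).Vertex, (∀ i, v i ∈ x i) ↔ v = a ∨ v = b :=
    fun v => (hcx v).symm.trans (hc v)
  have ha := (hmem a).2 (Or.inl rfl)
  have hb := (hmem b).2 (Or.inr rfl)
  obtain ⟨i, hi⟩ := Function.ne_iff.1 hne
  have hup : ∀ t ∈ x i, Function.update a i t = a ∨ Function.update a i t = b := by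
    intro t ht
    refine (hmem _).1 fun k => ?_
    by_cases hki : k = i
    · subst hki; simpa using ht
    · simpa [hki] using ha k
  refine ⟨i, fun k hki => ?_, hi, x i, hx i, fun t => ⟨fun ht => ?_, ?_⟩⟩
  · rcases hup _ (hb i) with h | h
    · exact absurd (by simpa using congrFun h i) hi.symm
    · simpa [hki] using congrFun h k
  · refine (hup t ht).imp (fun h => ?_) (fun h => ?_)
    · simpa using congrFun h i
    · simpa using congrFun h i
  · rintro (rfl | rfl)
    · exact ha i
    · exact hb i

/-- Edges in different directions span a box containing all three points, while `b` and `c` differ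
in two coordinates and form no edge. In the same direction, a box containing the three points has a
side containing `b i` and `c i`, which form an edge by closure under subsets if they are distinct.
-/
theorem parallel_iff [Finite ι] (hP : ∀ i, (P i).IsComplex) {i j : ι} {a b c : ∀ i, (P i).Vertex}
    (hb : EdgeAt P i a b) (hc : EdgeAt P j a c) : (pi P).Parallel a b c ↔ i = j := by
  classical
  constructor
  · rintro h
    by_contra hij
    rcases h with rfl | h | h
    · exact hij (hb.unique hc)
    · obtain ⟨k, hk⟩ := Edge.exists_edgeAt h
      have h1 : b i ≠ c i := fun h => hb.2.1 ((hc.1 i hij).trans h.symm)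
      have h2 : b j ≠ c j := fun h => hc.2.1 ((hb.1 j (Ne.symm hij)).trans h)
      obtain rfl : i = k := by_contra fun h => h1 (hk.1 i h)
      exact h2 (hk.1 j (Ne.symm hij))
    · obtain ⟨hb', -, d, hd, hdv⟩ := hb
      obtain ⟨hc', -, e, he, hev⟩ := hc
      obtain ⟨q, hq, hqv⟩ := exists_cell
        (Function.update (Function.update (fun k => {a k}) i d) j e) (fun k => by
          by_cases hkj : k = j
          · subst hkj; simpa using he
          · by_cases hki : k = i
            · subst hki; simpa [hkj] using hd
            · simpa [hki, hkj] using (P k).singleton_mem (a k))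
      refine h q hq ⟨(hqv a).2 fun k => ?_, (hqv b).2 fun k => ?_, (hqv c).2 fun k => ?_⟩
      all_goals
        by_cases hkj : k = j
        · subst hkj
          simp [hev, ← hb' k (Ne.symm hij)]
        · by_cases hki : k = i
          · subst hki
            simp [hkj, hdv, ← hc' k hij]
          · simp [hki, hkj, ← hb' k hki, ← hc' k hkj]
  · rintro rfl
    by_cases hbc : b = c
    · exact Or.inl hbc
    by_cases hbc' : (pi P).Edge b c
    · exact Or.inr (Or.inl hbc')
    refine Or.inr (Or.inr ?_)
    rintro d ⟨x, hx, hd⟩ ⟨-, hbd, hcd⟩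
    have hoff : ∀ k, k ≠ i → b k = c k := fun k hk => (hb.1 k hk).symm.trans (hc.1 k hk)
    refine hbc' (EdgeAt.edge (i := i) ⟨hoff, (hP i).edge (hx i) ((hd b).1 hbd i)
      ((hd c).1 hcd i) fun hi => hbc (funext fun k => ?_)⟩)
    by_cases hki : k = i
    · subst hki; exact hi
    · exact hoff k hki

end pi
-- Isomorphisms of products and their layers
/-- A bijection of base sets that matches the cells. -/
def Matches {X Y : CellSystem} (e : X.Vertex ≃ Y.Vertex) : Prop :=
  (∀ x ∈ X.cells, ∃ y ∈ Y.cells, ∀ v, v ∈ x ↔ e v ∈ y) ∧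
    ∀ y ∈ Y.cells, ∃ x ∈ X.cells, ∀ v, v ∈ x ↔ e v ∈ y

theorem Iso.exists_matches {X Y : CellSystem} (h : Iso X Y) :
    ∃ e : X.Vertex ≃ Y.Vertex, Matches e := by
  have aux : ∀ {X Y : CellSystem} (e : X.Vertex ≃ Y.Vertex),
      (∀ x, x ∈ X.cells ↔ x.map e.toEmbedding ∈ Y.cells) →
      ∀ y ∈ Y.cells, ∃ x ∈ X.cells, ∀ v, v ∈ x ↔ e v ∈ y := by
    intro X Y e he y hy
    refine ⟨y.map e.symm.toEmbedding, ?_, fun v => by simp [Finset.mem_map_equiv]⟩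
    rw [he, Finset.map_map]
    convert hy
    ext v
    simp
  obtain ⟨e, he⟩ := h
  exact ⟨e, fun x hx => ⟨_, (he x).1 hx, fun v => by simp⟩, aux e he⟩

theorem Matches.symm {X Y : CellSystem} {e : X.Vertex ≃ Y.Vertex} (h : Matches e) :
    Matches e.symm := by
  refine ⟨fun y hy => ?_, fun x hx => ?_⟩
  · obtain ⟨x, hx, hxy⟩ := h.2 y hy
    exact ⟨x, hx, fun v => by rw [hxy, e.apply_symm_apply]⟩
  · obtain ⟨y, hy, hxy⟩ := h.1 x hx
    exact ⟨y, hy, fun v => by rw [hxy, e.apply_symm_apply]⟩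

theorem Matches.edge {X Y : CellSystem} {e : X.Vertex ≃ Y.Vertex} (h : Matches e)
    {a b : X.Vertex} (hab : X.Edge a b) : Y.Edge (e a) (e b) := by
  obtain ⟨hne, c, hc, hcv⟩ := hab
  obtain ⟨d, hd, hcd⟩ := h.1 c hc
  refine ⟨e.injective.ne hne, d, hd, fun v => ?_⟩
  obtain ⟨v, rfl⟩ := e.surjective v
  rw [← hcd, hcv, e.apply_eq_iff_eq, e.apply_eq_iff_eq]

theorem Matches.parallel {X Y : CellSystem} {e : X.Vertex ≃ Y.Vertex} (h : Matches e)
    {a b c : X.Vertex} (habc : X.Parallel a b c) : Y.Parallel (e a) (e b) (e c) := by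
  refine habc.imp (congrArg e) (Or.imp h.edge fun hn d hd => ?_)
  obtain ⟨x, hx, hxd⟩ := h.2 d hd
  rw [← hxd, ← hxd, ← hxd]
  exact hn x hx

section pi

variable {ι κ : Type} {P : ι → CellSystem} {Q : κ → CellSystem}

open Function in
theorem edgeAt_update [DecidableEq ι] (u : ∀ i, (P i).Vertex) (i : ι) {s t : (P i).Vertex}
    (h : (P i).Edge s t) : EdgeAt P i (update u i s) (update u i t) :=
  ⟨fun k hk => by simp [hk], by simpa using h⟩

variable [DecidableEq ι] {e : (∀ i, (P i).Vertex) ≃ ∀ j, (Q j).Vertex}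

open Function in
/-- An isomorphism of products of simplicial complexes maps each layer of a connected factor into
a layer. -/
theorem exists_layer [Finite ι] [Finite κ] (hP : ∀ i, (P i).IsComplex) (hQ : ∀ j, (Q j).IsComplex)
    (he : Matches (X := pi P) (Y := pi Q) e) (u : ∀ i, (P i).Vertex) (i : ι)
    (hi : Conn (P i)) [Nontrivial (P i).Vertex] :
    ∃ j, ∀ t, ∀ k, k ≠ j → e (update u i t) k = e u k := by
  have hedge : ∀ {s t}, (P i).Edge s t → ∃ j, EdgeAt Q j (e (update u i s)) (e (update u i t)) :=
    fun h => Edge.exists_edgeAt (he.edge (edgeAt_update u i h).edge)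
  obtain ⟨v, hv⟩ := (hP i).exists_edge hi (u i)
  obtain ⟨j, hj⟩ := hedge hv
  -- Besides staying in the layer, each `t` carries an edge already known to map to direction `j`;
  -- the next edge at `t` is parallel to it, so it has direction `j` too.
  have hC := (hP i).eq_univ hi (C := {t | (∀ k, k ≠ j → e (update u i t) k = e u k) ∧
    ∃ t', (P i).Edge t t' ∧ EdgeAt Q j (e (update u i t)) (e (update u i t'))}) ?_ ⟨u i, ?_⟩
  · exact ⟨j, fun t => (hC.ge (Set.mem_univ t)).1⟩
  · rintro t s hts ⟨ht, t', htt', hj'⟩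
    obtain ⟨j', hj''⟩ := hedge hts
    obtain rfl : j = j' := (parallel_iff hQ hj' hj'').1
      (he.parallel ((parallel_iff hP (edgeAt_update u i htt') (edgeAt_update u i hts)).2 rfl))
    exact ⟨fun k hk => (hj''.1 k hk).symm.trans (ht k hk), t, hts.symm, hj''.symm⟩
  · exact ⟨fun k _ => by rw [update_eq_self], v, hv, hj⟩

open Function in
theorem apply_update_eq [DecidableEq κ] {u : ∀ i, (P i).Vertex} {u' : ∀ j, (Q j).Vertex} {i : ι} {j : κ}
    (h : ∀ t, ∀ k, k ≠ j → e (update u i t) k = u' k) (t : (P i).Vertex) :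
    e (update u i t) = update u' j (e (update u i t) j) := by
  ext k
  by_cases hk : k = j
  · subst hk; simp
  · simp [hk, h t k hk]

open Function in
-- A point moved off `u` in coordinate `i` goes to the `j`-layer and comes back to itself; but
-- returning into the `i'`-layer would reset coordinate `i` to `u i` if `i ≠ i'`.
theorem layer_index_unique [DecidableEq κ] {u : ∀ i, (P i).Vertex} {u' : ∀ j, (Q j).Vertex} {i i' : ι} {j : κ}
    [Nontrivial (P i).Vertex]
    (h : ∀ t, ∀ k, k ≠ j → e (update u i t) k = u' k)
    (h' : ∀ s, ∀ k, k ≠ i' → e.symm (update u' j s) k = u k) : i = i' := by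
  by_contra hne
  obtain ⟨t, ht⟩ := exists_ne (u i)
  have := h' (e (update u i t) j) i hne
  rw [← apply_update_eq h t, e.symm_apply_apply, update_self] at this
  exact ht this

open Function in
-- The box with side `x` at `i` and singletons elsewhere maps to a box. Along the layer all target
-- coordinates except `j` are constant, so only the side at `j` decides membership.
theorem exists_layer_cell [Finite ι] [Finite κ] (he : Matches (X := pi P) (Y := pi Q) e)
    {u : ∀ i, (P i).Vertex} {u' : ∀ j, (Q j).Vertex} {i : ι} {j : κ}
    (h : ∀ t, ∀ k, k ≠ j → e (update u i t) k = u' k)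
    {x : Finset (P i).Vertex} (hx : x ∈ (P i).cells) :
    ∃ y ∈ (Q j).cells, ∀ t, t ∈ x ↔ e (update u i t) j ∈ y := by
  obtain ⟨c, hc, hcv⟩ := exists_cell (P := P) (update (fun k => {u k}) i x) (fun k => by
    by_cases hki : k = i
    · subst hki; simpa using hx
    · simpa [hki] using (P k).singleton_mem (u k))
  have hcx : ∀ t, update u i t ∈ c ↔ t ∈ x := fun t => by
    refine (hcv _).trans ⟨fun hk => by simpa using hk i, fun ht k => ?_⟩
    by_cases hki : k = i
    · subst hki; simpa using ht
    · simp [hki]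
  obtain ⟨d, ⟨y, hy, hyd⟩, hcd⟩ := he.1 c hc
  have hxy : ∀ t, t ∈ x ↔ ∀ k, e (update u i t) k ∈ y k := fun t =>
    (hcx t).symm.trans ((hcd _).trans (hyd _))
  refine ⟨y j, hy j, fun t => ⟨fun ht => (hxy t).1 ht j, fun ht => (hxy t).2 fun k => ?_⟩⟩
  obtain ⟨s, hs⟩ := (P i).nonempty_of_mem x hx
  by_cases hk : k = j
  · subst hk; exact ht
  · rw [h t k hk, ← h s k hk]
    exact (hxy s).1 hs k

open Function in
theorem layer_iso [Finite ι] [Finite κ] [DecidableEq κ] (he : Matches (X := pi P) (Y := pi Q) e)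
    {u : ∀ i, (P i).Vertex} {u' : ∀ j, (Q j).Vertex} {i : ι} {j : κ}
    (h : ∀ t, ∀ k, k ≠ j → e (update u i t) k = u' k)
    (h' : ∀ s, ∀ k, k ≠ i → e.symm (update u' j s) k = u k) : Iso (P i) (Q j) := by
  let g : (P i).Vertex ≃ (Q j).Vertex :=
    { toFun := fun t => e (update u i t) j
      invFun := fun s => e.symm (update u' j s) i
      left_inv := fun t => by simp [← apply_update_eq h t]
      right_inv := fun s => by simp [← apply_update_eq h' s] }
  refine Iso.of_exists g (fun x hx => exists_layer_cell he h hx) fun y hy => ?_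
  obtain ⟨x, hx, hxy⟩ := exists_layer_cell he.symm h' hy
  exact ⟨x, hx, fun t => ((hxy (g t)).trans (iff_of_eq (congrArg (· ∈ x) (g.left_inv t)))).symm⟩

end pi

/-- The factors of a product of connected simplicial complexes with more than one vertex are
determined up to isomorphism and order. -/
theorem exists_equiv_of_pi_iso {ι κ : Type} [Finite ι] [Finite κ] {P : ι → CellSystem}
    {Q : κ → CellSystem} (hP : ∀ i, (P i).IsComplex ∧ Conn (P i) ∧ Nontrivial (P i).Vertex)
    (hQ : ∀ j, (Q j).IsComplex ∧ Conn (Q j) ∧ Nontrivial (Q j).Vertex)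
    (h : Iso (pi P) (pi Q)) : ∃ σ : ι ≃ κ, ∀ i, Iso (P i) (Q (σ i)) := by
  classical
  obtain ⟨e, he⟩ := h.exists_matches
  change (∀ i, (P i).Vertex) ≃ ∀ j, (Q j).Vertex at e
  have hPn := fun i => (hP i).2.2
  have hQn := fun j => (hQ j).2.2
  let u : ∀ i, (P i).Vertex := fun i => (hP i).2.1.1.some
  choose σ hσ using fun i => exists_layer (fun i => (hP i).1) (fun j => (hQ j).1) he u i (hP i).2.1
  choose τ hτ using fun j =>
    exists_layer (fun j => (hQ j).1) (fun i => (hP i).1) he.symm (e u) j (hQ j).2.1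
  replace hτ : ∀ j s k, k ≠ τ j → e.symm (Function.update (e u) j s) k = u k :=
    fun j s k hk => (hτ j s k hk).trans (congrFun (e.symm_apply_apply u) k)
  have hστ : ∀ i, τ (σ i) = i := fun i => (layer_index_unique (hσ i) (hτ (σ i))).symm
  have hτσ : ∀ j, σ (τ j) = j := fun j => (layer_index_unique (hτ j) (hσ (τ j))).symm
  refine ⟨⟨σ, τ, hστ, hτσ⟩, fun i => layer_iso he (hσ i) ?_⟩
  have := hτ (σ i)
  rwa [hστ i] at this

/-! ### Isomorphism classes and monomials -/

theorem isoClass_eq_iff {X Y : CellSystem} : isoClass X = isoClass Y ↔ Iso X Y :=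
  ⟨fun h => Quotient.exact h, fun h => Quotient.sound h⟩

theorem isoClass_prod (X Y : CellSystem) : isoClass (X.prod Y) = isoClass X * isoClass Y := rfl

theorem iso_point {X : CellSystem} [Nonempty X.Vertex] [Subsingleton X.Vertex] : Iso X point := by
  have hall : ∀ {Z : CellSystem} [Subsingleton Z.Vertex], ∀ x ∈ Z.cells, ∀ v, v ∈ x := by
    intro Z _ x hx v
    obtain ⟨w, hw⟩ := Z.nonempty_of_mem x hx
    exact Subsingleton.elim w v ▸ hw
  have : Subsingleton point.Vertex := inferInstanceAs (Subsingleton Unit)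
  obtain ⟨a⟩ := ‹Nonempty X.Vertex›
  let e : X.Vertex ≃ point.Vertex :=
    ⟨fun _ => (), fun _ => a, fun _ => Subsingleton.elim _ _, fun _ => Subsingleton.elim _ _⟩
  exact Iso.of_exists e
    (fun x hx => ⟨_, point.singleton_mem (), fun v => iff_of_true (hall x hx v)
      (hall _ (point.singleton_mem ()) _)⟩)
    fun y hy => ⟨_, X.singleton_mem a, fun v => iff_of_true (hall _ (X.singleton_mem a) v)
      (hall y hy _)⟩

theorem pi_fin_succ_iso {n : ℕ} (P : Fin (n + 1) → CellSystem) :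
    Iso (pi P) ((P 0).prod (pi fun i : Fin n => P i.succ)) := by
  refine Iso.of_exists (Fin.consEquiv fun i => (P i).Vertex).symm ?_ ?_
  · rintro c ⟨x, hx, hc⟩
    obtain ⟨d, hd, hdv⟩ := exists_cell (P := fun i : Fin n => P i.succ) (fun i : Fin n => x i.succ)
      fun i => hx i.succ
    refine ⟨_, ⟨x 0, hx 0, d, hd, rfl⟩, fun v => ((hc v).trans Fin.forall_fin_succ).trans ?_⟩
    exact Iff.trans (and_congr Iff.rfl (hdv fun i => v i.succ).symm)
      (Finset.mem_product (s := x 0) (t := d) (p := (v 0, fun i => v i.succ))).symm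
  · rintro _ ⟨x, hx, d, ⟨y, hy, hd⟩, rfl⟩
    obtain ⟨c, hc, hcv⟩ := exists_cell (P := P) (Fin.cons x y) (Fin.cases hx hy)
    refine ⟨c, hc, fun v => ((hcv v).trans Fin.forall_fin_succ).trans ?_⟩
    exact Iff.trans (and_congr Iff.rfl (hd fun i => v i.succ).symm)
      (Finset.mem_product (s := x) (t := d) (p := (v 0, fun i => v i.succ))).symm

theorem isoClass_pi {n : ℕ} (P : Fin n → CellSystem) : isoClass (pi P) = ∏ i, isoClass (P i) := by
  induction n with
  | zero =>
    have : Nonempty (pi P).Vertex := inferInstanceAs (Nonempty (∀ i : Fin 0, (P i).Vertex))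
    have : Subsingleton (pi P).Vertex := inferInstanceAs (Subsingleton (∀ i : Fin 0, (P i).Vertex))
    rw [Fin.prod_univ_zero]
    exact Quotient.sound iso_point
  | succ n ih =>
    rw [Fin.prod_univ_succ, ← ih fun i => P i.succ, ← isoClass_prod, isoClass_eq_iff]
    exact pi_fin_succ_iso P

/-- Isomorphism classes of connected simplicial complexes with more than one vertex. -/
abbrev PrimeClass : Type 1 :=
  {c : IsoClass // ∃ X : CellSystem, X.IsComplex ∧ Conn X ∧ Nontrivial X.Vertex ∧ isoClass X = c}

/-- A product of connected simplicial complexes with more than one vertex determines its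
factors. -/
theorem prod_primeClass_injective :
    Function.Injective fun s : Multiset PrimeClass => (s.map Subtype.val).prod := by
  choose X hXs hXc hXn hX using fun c : PrimeClass => c.2
  -- Ordering the multiset as a list turns its product into a `pi` indexed by `Fin`, to which the
  -- matching of factors applies.
  have key : ∀ l : List PrimeClass, ((l : Multiset PrimeClass).map Subtype.val).prod =
      isoClass (pi fun i => X (l.get i)) := by
    intro l
    simp only [isoClass_pi, hX]
    rw [Multiset.map_coe, Multiset.prod_coe, ← List.prod_ofFn]
    exact congrArg List.prod
      ((congrArg (List.map Subtype.val) (List.ofFn_get l)).symm.trans List.map_ofFn)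
  intro s t
  refine Quotient.inductionOn₂ s t fun l l' h => ?_
  have h' : isoClass (pi fun i => X (l.get i)) = isoClass (pi fun i => X (l'.get i)) :=
    (key l).symm.trans (h.trans (key l'))
  obtain ⟨σ, hσ⟩ := exists_equiv_of_pi_iso (fun i => ⟨hXs _, hXc _, hXn _⟩)
    (fun i => ⟨hXs _, hXc _, hXn _⟩) (isoClass_eq_iff.1 h')
  have hget : ∀ i, l.get i = l'.get (σ i) := fun i => by
    rw [Subtype.ext_iff, ← hX, ← hX (l'.get _), isoClass_eq_iff]
    exact hσ i
  have hl : ∀ l : List PrimeClass, (l : Multiset PrimeClass) = Finset.univ.val.map l.get :=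
    fun l => by rw [Fin.univ_val_map, List.ofFn_get]
  change (l : Multiset PrimeClass) = l'
  rw [hl l, hl l', ← Finset.map_univ_equiv σ, Finset.map_val, Multiset.map_map]
  exact Multiset.map_congr rfl fun i _ => hget i

theorem exists_conn_of_prod (s : Multiset PrimeClass) :
    ∃ X : CellSystem, Conn X ∧ isoClass X = (s.map Subtype.val).prod := by
  induction s using Multiset.induction_on with
  | empty => exact ⟨point, conn_point, rfl⟩
  | cons a s ih =>
    obtain ⟨X, hX, hs⟩ := ih
    obtain ⟨Y, -, hY, -, ha⟩ := a.2
    exact ⟨Y.prod X, hY.prod hX, by rw [Multiset.map_cons, Multiset.prod_cons, ← hs, ← ha]; rfl⟩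

/-- The product of prime classes with the given exponents. -/
noncomputable def monomialClass (m : PrimeClass →₀ ℕ) : IsoClass :=
  m.prod fun i k => i.1 ^ k

theorem monomialClass_eq (m : PrimeClass →₀ ℕ) :
    monomialClass m = (m.toMultiset.map Subtype.val).prod := by
  rw [Finsupp.toMultiset_map, Finsupp.prod_toMultiset,
    Finsupp.prod_mapDomain_index (fun _ => pow_zero _) fun _ _ _ => pow_add _ _ _]
  rfl

theorem monomialClass_injective : Function.Injective monomialClass := fun m m' h => by
  classical
  rw [monomialClass_eq, monomialClass_eq] at h
  simpa using congrArg Multiset.toFinsupp (prod_primeClass_injective h)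

/-! ### Linear independence in the Grothendieck ring -/

/-- The number of components isomorphic to `p`, on isomorphism classes. -/
noncomputable def countClass (p : CellSystem) : IsoClass → ℤ :=
  Quotient.lift (fun X => (count p X : ℤ)) fun _ _ h => congrArg Nat.cast (count_congr p h)

/-- The number of components isomorphic to `p`, extended linearly. -/
noncomputable def countHom (p : CellSystem) : MonoidAlgebra ℤ IsoClass →+ ℤ :=
  MonoidAlgebra.liftNC (AddMonoidHom.id ℤ) (countClass p)

theorem countHom_single (p : CellSystem) (c : IsoClass) (z : ℤ) :
    countHom p (MonoidAlgebra.single c z) = z * countClass p c :=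
  MonoidAlgebra.liftNC_single _ _ _ _

theorem countClass_mul_sum {p : CellSystem} (hp : Conn p) (c : IsoClass) (X Y : CellSystem) :
    countClass p (c * isoClass (X.sum Y)) =
      countClass p (c * isoClass X) + countClass p (c * isoClass Y) := by
  induction c using Quotient.inductionOn with
  | h Z =>
    change countClass p (isoClass Z * _) = countClass p (isoClass Z * _) +
      countClass p (isoClass Z * _)
    rw [mul_comm, mul_comm (isoClass Z), mul_comm (isoClass Z), ← isoClass_prod,
      isoClass_eq_iff.2 (sum_prod X Y Z)]
    change ((count p ((X.prod Z).sum (Y.prod Z)) : ℕ) : ℤ) = _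
    rw [count_sum hp, Nat.cast_add]
    rfl

theorem countHom_eq_zero {p : CellSystem} (hp : Conn p) {x : MonoidAlgebra ℤ IsoClass}
    (hx : x ∈ disjointUnionIdeal) : countHom p x = 0 := by
  -- `countHom p` is only additive, so vanishing is proved for all multiples to survive the ideal
  -- operations.
  suffices h : ∀ a, countHom p (a * x) = 0 by simpa using h 1
  induction hx using Submodule.span_induction with
  | mem x h =>
    obtain ⟨X, Y, rfl⟩ := h
    intro a
    induction a using MonoidAlgebra.induction_linear with
    | zero => simp
    | add x y hx hy => rw [add_mul, map_add, hx, hy, add_zero]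
    | single c z =>
      simp only [mul_sub, mul_add, MonoidAlgebra.of_apply, MonoidAlgebra.single_mul_single,
        map_sub, map_add, countHom_single, countClass_mul_sum hp]
      ring
  | zero => simp
  | add x y _ _ hx hy => intro a; rw [mul_add, map_add, hx, hy, add_zero]
  | smul b x _ hx => intro a; rw [smul_eq_mul, ← mul_assoc]; exact hx _

/-- The polynomial ring on the prime classes, mapped to the monoid algebra. -/
noncomputable def polyToAlgebra : MvPolynomial PrimeClass ℤ →+* MonoidAlgebra ℤ IsoClass :=
  (MvPolynomial.aeval fun i : PrimeClass => MonoidAlgebra.of ℤ IsoClass i.1).toRingHom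

theorem polyToAlgebra_X (i : PrimeClass) :
    polyToAlgebra (MvPolynomial.X i) = MonoidAlgebra.of ℤ IsoClass i.1 :=
  MvPolynomial.aeval_X _ _

theorem polyToAlgebra_monomial (m : PrimeClass →₀ ℕ) (z : ℤ) :
    polyToAlgebra (MvPolynomial.monomial m z) = MonoidAlgebra.single (monomialClass m) z := by
  have h : (m.prod fun i k => MonoidAlgebra.of ℤ IsoClass i.1 ^ k) =
      MonoidAlgebra.of ℤ IsoClass (monomialClass m) := by
    rw [monomialClass, Finsupp.prod, Finsupp.prod, map_prod]
    simp only [map_pow]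
  change MvPolynomial.aeval _ _ = _
  rw [MvPolynomial.aeval_monomial, h, MonoidAlgebra.of_apply, eq_intCast, ← zsmul_eq_mul]
  simp

/-- Distinct products of connected simplicial complexes are linearly independent in the
Grothendieck ring. -/
theorem eq_zero_of_polyToAlgebra_mem {f : MvPolynomial PrimeClass ℤ}
    (hf : polyToAlgebra f ∈ disjointUnionIdeal) : f = 0 := by
  ext m
  obtain ⟨p, hp, hpm⟩ := exists_conn_of_prod m.toMultiset
  rw [← monomialClass_eq] at hpm
  -- A monomial is represented by a connected system, whose count is 1 if it is isomorphic to `p`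
  -- and 0 otherwise.
  have key : ∀ f : MvPolynomial PrimeClass ℤ, countHom p (polyToAlgebra f) = f.coeff m := by
    classical
    intro f
    induction f using MvPolynomial.induction_on' with
    | monomial n z =>
      rw [polyToAlgebra_monomial, countHom_single, MvPolynomial.coeff_monomial]
      obtain ⟨q, hq, hqn⟩ := exists_conn_of_prod n.toMultiset
      rw [← monomialClass_eq] at hqn
      rw [← hqn]
      change z * ((count p q : ℕ) : ℤ) = _
      by_cases hnm : n = m
      · subst hnm
        rw [count_eq_one hq (isoClass_eq_iff.1 (hqn.trans hpm.symm))]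
        simp
      · rw [count_eq_zero hp hq fun h => hnm (monomialClass_injective
          (hqn.symm.trans ((isoClass_eq_iff.2 h).trans hpm)))]
        simp [hnm]
    | add f g hf hg => rw [map_add, map_add, hf, hg, MvPolynomial.coeff_add]
  rw [← key, countHom_eq_zero hp hf, MvPolynomial.coeff_zero]

/-! ### Decomposition of complexes in the Grothendieck ring -/

theorem toRing_congr {X Y : CellSystem} (h : Iso X Y) : toRing X = toRing Y := by
  rw [toRing, toRing, isoClass_eq_iff.2 h]

theorem toRing_sum (X Y : CellSystem) : toRing (X.sum Y) = toRing X + toRing Y := by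
  rw [toRing, toRing, toRing, ← map_add, Ideal.Quotient.eq]
  exact Ideal.subset_span ⟨X, Y, rfl⟩

theorem toRing_point : toRing point = 1 := by
  change Ideal.Quotient.mk disjointUnionIdeal (MonoidAlgebra.of ℤ IsoClass 1) = 1
  rw [map_one, map_one]

/-- The empty system satisfies `X ⊕ X ≅ X`, so its class is idempotent under addition. -/
theorem toRing_of_isEmpty {X : CellSystem} [IsEmpty X.Vertex] : toRing X = 0 := by
  have hX : ∀ x ∈ X.cells, False := fun x hx => by
    obtain ⟨v, -⟩ := X.nonempty_of_mem x hx
    exact isEmptyElim v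
  have h : Iso (X.sum X) X := Iso.of_exists (Equiv.sumEmpty X.Vertex X.Vertex)
    (fun x hx => by rcases hx with ⟨y, hy, -⟩ | ⟨y, hy, -⟩ <;> exact (hX y hy).elim)
    fun y hy => (hX y hy).elim
  simpa [toRing_sum] using toRing_congr h

/-- A simplicial complex is the disjoint union of its connected components. -/
theorem exists_poly_of_isComplex (X : CellSystem) (hX : X.IsComplex) :
    ∃ f : MvPolynomial PrimeClass ℤ, (∀ m, 0 ≤ f.coeff m) ∧
      Ideal.Quotient.mk disjointUnionIdeal (polyToAlgebra f) = toRing X := by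
  classical
  induction hn : Nat.card X.Vertex using Nat.strong_induction_on generalizing X with
  | _ n ih =>
    have := X.finite_vertex
    rcases isEmpty_or_nonempty X.Vertex with hemp | hne
    · exact ⟨0, by simp, by rw [map_zero, map_zero, toRing_of_isEmpty]⟩
    by_cases hc : Conn X
    · rcases subsingleton_or_nontrivial X.Vertex with hs | hs
      · refine ⟨1, fun m => ?_, ?_⟩
        · rw [MvPolynomial.coeff_one]; split_ifs <;> simp
        · rw [map_one, map_one, toRing_congr iso_point, toRing_point]
      · refine ⟨MvPolynomial.X ⟨isoClass X, X, hX, hc, hs, rfl⟩, fun m => ?_, ?_⟩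
        · rw [MvPolynomial.coeff_X]; split_ifs <;> simp
        · rw [polyToAlgebra_X]; rfl
    -- A disconnected complex splits along a proper nonempty saturated set into two complexes with
    -- fewer vertices.
    · obtain ⟨C, hC, ⟨a, ha⟩, hCu⟩ : ∃ C : Set X.Vertex, X.Saturated C ∧ C.Nonempty ∧
          C ≠ Set.univ := by
        by_contra! h
        exact hc ⟨hne, h⟩
      obtain ⟨b, hb⟩ := (Set.ne_univ_iff_exists_notMem C).1 hCu
      have hlt : ∀ D : Set X.Vertex, (∃ v, v ∉ D) → Nat.card (X.restrict D).Vertex < n := by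
        rintro D ⟨v, hv⟩
        rw [← hn]
        exact Finite.card_subtype_lt hv
      obtain ⟨f, hf, hfX⟩ := ih _ (hlt C ⟨b, hb⟩) _ (hX.restrict C) rfl
      obtain ⟨g, hg, hgX⟩ := ih _ (hlt Cᶜ ⟨a, fun h => h ha⟩) _ (hX.restrict Cᶜ) rfl
      refine ⟨f + g, fun m => ?_, ?_⟩
      · rw [MvPolynomial.coeff_add]; exact add_nonneg (hf m) (hg m)
      · rw [map_add, map_add, hfX, hgX, ← toRing_sum, toRing_congr (iso_sum_restrict hC)]

end CellSystem

open CellSystem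

theorem toRing_mem_strongRing {X : CellSystem} (hX : X.IsComplex) : toRing X ∈ strongRing := by
  have := X.finite_vertex
  exact Subring.subset_closure ⟨X.Vertex, X.finite_vertex, hX.toComplex, rfl⟩

/-! ### The strong ring as a polynomial ring -/

/-- The polynomial ring on the prime classes, mapped to the strong ring. -/
noncomputable def polyToStrong : MvPolynomial PrimeClass ℤ →+* strongRing :=
  ((Ideal.Quotient.mk disjointUnionIdeal).comp polyToAlgebra).codRestrict strongRing fun f => by
    induction f using MvPolynomial.induction_on with
    | C a =>
      rw [eq_intCast MvPolynomial.C a, map_intCast]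
      exact intCast_mem strongRing a
    | add f g hf hg => rw [map_add]; exact add_mem hf hg
    | mul_X f i hf =>
      rw [map_mul]
      refine mul_mem hf ?_
      obtain ⟨X, hX, -, -, h⟩ := i.2
      rw [RingHom.comp_apply, polyToAlgebra_X, ← h]
      exact toRing_mem_strongRing hX

theorem coe_polyToStrong (f : MvPolynomial PrimeClass ℤ) :
    (polyToStrong f : GrothendieckRing) =
      Ideal.Quotient.mk disjointUnionIdeal (polyToAlgebra f) := rfl

theorem exists_polyToStrong_eq_complexClass {V : Type} [Finite V]
    (K : AbstractSimplicialComplex V) :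
    ∃ f : MvPolynomial PrimeClass ℤ, (∀ m, 0 ≤ f.coeff m) ∧ polyToStrong f = complexClass K := by
  obtain ⟨f, hf, h⟩ := exists_poly_of_isComplex _ (isComplex_ofComplex K)
  exact ⟨f, hf, Subtype.ext h⟩

theorem polyToStrong_injective : Function.Injective polyToStrong := by
  rw [injective_iff_map_eq_zero]
  intro f hf
  refine eq_zero_of_polyToAlgebra_mem (Ideal.Quotient.eq_zero_iff_mem.1 ?_)
  rw [← coe_polyToStrong, hf]
  rfl

theorem polyToStrong_surjective : Function.Surjective polyToStrong := by
  rintro ⟨g, hg⟩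
  have hle : strongRing ≤ ((Ideal.Quotient.mk disjointUnionIdeal).comp polyToAlgebra).range := by
    refine Subring.closure_le.2 ?_
    rintro _ ⟨V, _, K, rfl⟩
    obtain ⟨f, -, h⟩ := exists_poly_of_isComplex _ (isComplex_ofComplex K)
    exact ⟨f, h⟩
  obtain ⟨f, h⟩ := hle hg
  exact ⟨f, Subtype.ext h⟩

/-- The strong ring is the polynomial ring over `ℤ` on the connected simplicial complexes with
more than one vertex. -/
noncomputable def strongRingEquiv : MvPolynomial PrimeClass ℤ ≃+* strongRing :=
  RingEquiv.ofBijective polyToStrong ⟨polyToStrong_injective, polyToStrong_surjective⟩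

/-- The complex classes of connected complexes with more than one vertex are the variables. -/
theorem exists_variable_iff (G : strongRing) :
    (∃ i, G = strongRingEquiv (MvPolynomial.X i)) ↔
      ∃ (V : Type) (_ : Finite V) (K : AbstractSimplicialComplex V),
        (connectionGraph K).Connected ∧ Nontrivial V ∧ G = complexClass K := by
  constructor
  · rintro ⟨⟨c, X, hX, hc, hn, rfl⟩, rfl⟩
    have := X.finite_vertex
    refine ⟨X.Vertex, X.finite_vertex, hX.toComplex, ?_, hn, Subtype.ext ?_⟩
    · exact (conn_ofComplex_iff hX.toComplex).1 hc
    · change Ideal.Quotient.mk _ (polyToAlgebra _) = _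
      rw [polyToAlgebra_X]
      rfl
  · rintro ⟨V, _, K, hK, hV, rfl⟩
    refine ⟨⟨isoClass (ofComplex K), ofComplex K, isComplex_ofComplex K,
      (conn_ofComplex_iff K).2 hK, hV, rfl⟩, Subtype.ext ?_⟩
    change _ = Ideal.Quotient.mk _ (polyToAlgebra _)
    rw [polyToAlgebra_X]
    rfl

/-! ### Unsigned elements and additive primes -/

theorem strongRingEquiv_X_mem (i : PrimeClass) :
    strongRingEquiv (MvPolynomial.X i) ∈ unsignedElements := by
  obtain ⟨V, hV, K, -, -, h⟩ := (exists_variable_iff _).1 ⟨i, rfl⟩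
  exact h ▸ Subsemiring.subset_closure ⟨V, hV, K, rfl⟩

/-- Nonnegativity of coefficients holds for complexes and survives sums and products; conversely
such a polynomial is a sum of natural multiples of products of variables. -/
theorem strongRingEquiv_mem_unsignedElements_iff (f : MvPolynomial PrimeClass ℤ) :
    strongRingEquiv f ∈ unsignedElements ↔ ∀ m, 0 ≤ f.coeff m := by
  classical
  constructor
  · intro h
    suffices hs : ∀ G ∈ unsignedElements, ∀ m, 0 ≤ (strongRingEquiv.symm G).coeff m by
      simpa using hs _ h
    intro G hG
    induction hG using Subsemiring.closure_induction with
    | mem G hG =>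
      obtain ⟨V, _, K, rfl⟩ := hG
      obtain ⟨f, hf, hfK⟩ := exists_polyToStrong_eq_complexClass K
      have : strongRingEquiv.symm (complexClass K) = f :=
        (RingEquiv.symm_apply_eq _).2 hfK.symm
      rwa [this]
    | zero => simp
    | one =>
      intro m
      rw [map_one, MvPolynomial.coeff_one]
      split_ifs <;> simp
    | add x y _ _ hx hy =>
      intro m
      rw [map_add, MvPolynomial.coeff_add]
      exact add_nonneg (hx m) (hy m)
    | mul x y _ _ hx hy =>
      intro m
      rw [map_mul, MvPolynomial.coeff_mul]
      exact Finset.sum_nonneg fun _ _ => mul_nonneg (hx _) (hy _)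
  · intro h
    rw [f.as_sum, map_sum]
    refine sum_mem fun m _ => ?_
    obtain ⟨n, hn⟩ := Int.eq_ofNat_of_zero_le (h m)
    rw [MvPolynomial.monomial_eq, map_mul, Finsupp.prod, map_prod, hn]
    refine mul_mem ?_ (prod_mem fun i _ => ?_)
    · have : strongRingEquiv (MvPolynomial.C (n : ℤ)) = (n : strongRing) := by simp
      rw [this]
      exact natCast_mem _ n
    · rw [map_pow]
      exact pow_mem (strongRingEquiv_X_mem i) _

/-- A monomial of the support can be split off, leaving nonnegative coefficients, so the remainder
must vanish. Conversely, the coefficient 1 is not a sum of two positive integers. -/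
theorem isUnsignedAdditivePrime_iff (f : MvPolynomial PrimeClass ℤ) :
    IsUnsignedAdditivePrime (strongRingEquiv f) ↔ ∃ m, f = MvPolynomial.monomial m 1 := by
  classical
  constructor
  · rintro ⟨hf, hf0, h⟩
    rw [strongRingEquiv_mem_unsignedElements_iff] at hf
    have hf0 : f ≠ 0 := fun h => hf0 (by rw [h, map_zero])
    obtain ⟨m, hm⟩ := MvPolynomial.ne_zero_iff.1 hf0
    have hpos : 1 ≤ f.coeff m := lt_of_le_of_ne (hf m) hm.symm
    have h1 : (MvPolynomial.monomial m (1 : ℤ)) ≠ 0 := by simp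
    have := h (strongRingEquiv (MvPolynomial.monomial m 1)) ?_
      (strongRingEquiv (f - MvPolynomial.monomial m 1)) ?_ ?_
    · simp only [map_eq_zero_iff _ strongRingEquiv.injective, h1, false_or, sub_eq_zero] at this
      exact ⟨m, this⟩
    · rw [strongRingEquiv_mem_unsignedElements_iff]
      intro k
      rw [MvPolynomial.coeff_monomial]
      split_ifs <;> simp
    · rw [strongRingEquiv_mem_unsignedElements_iff]
      intro k
      rw [MvPolynomial.coeff_sub, MvPolynomial.coeff_monomial]
      split_ifs with hk
      · subst hk; linarith
      · simpa using hf k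
    · rw [← map_add, add_sub_cancel]
  · rintro ⟨m, rfl⟩
    refine ⟨?_, ?_, ?_⟩
    · rw [strongRingEquiv_mem_unsignedElements_iff]
      intro k
      rw [MvPolynomial.coeff_monomial]
      split_ifs <;> simp
    · simp [map_eq_zero_iff _ strongRingEquiv.injective]
    · intro A hA B hB hAB
      obtain ⟨a, rfl⟩ := strongRingEquiv.surjective A
      obtain ⟨b, rfl⟩ := strongRingEquiv.surjective B
      rw [strongRingEquiv_mem_unsignedElements_iff] at hA hB
      rw [← map_add, strongRingEquiv.injective.eq_iff] at hAB
      have hc : ∀ k, (if m = k then (1 : ℤ) else 0) = a.coeff k + b.coeff k := fun k => by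
        rw [← MvPolynomial.coeff_add, ← hAB, MvPolynomial.coeff_monomial]
      simp only [map_eq_zero_iff _ strongRingEquiv.injective]
      have hm := hc m
      have hAm := hA m
      have hBm := hB m
      rw [if_pos rfl] at hm
      have hoff : ∀ k, m ≠ k → a.coeff k = 0 ∧ b.coeff k = 0 := fun k hk => by
        have h1 := hc k
        have h2 := hA k
        have h3 := hB k
        rw [if_neg hk] at h1
        omega
      rcases (by omega : a.coeff m = 0 ∨ b.coeff m = 0) with h0 | h0
      · refine Or.inl (MvPolynomial.ext _ _ fun k => ?_)
        by_cases hk : m = k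
        · subst hk; simpa using h0
        · simpa using (hoff k hk).1
      · refine Or.inr (MvPolynomial.ext _ _ fun k => ?_)
        by_cases hk : m = k
        · subst hk; simpa using h0
        · simpa using (hoff k hk).2

/-! ### Units, irreducibles and the main theorem -/

theorem strongRing_isUnit_iff (G : strongRing) : IsUnit G ↔ G = 1 ∨ G = -1 := by
  constructor
  · intro h
    obtain ⟨r, hr, h⟩ := MvPolynomial.isUnit_iff_eq_C_of_isReduced.1
      (h.map strongRingEquiv.symm)
    rw [RingEquiv.symm_apply_eq] at h
    rcases Int.isUnit_iff.1 hr with rfl | rfl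
    · exact Or.inl (by simpa using h)
    · exact Or.inr (by simpa using h)
  · rintro (rfl | rfl)
    · exact isUnit_one
    · exact isUnit_one.neg

theorem isMultiplicativePrime_iff (G : strongRing) :
    IsMultiplicativePrime G ↔ Irreducible G := by
  rw [irreducible_iff, IsMultiplicativePrime, strongRing_isUnit_iff]
  simp only [strongRing_isUnit_iff]

theorem strongRing_associated_iff (G H : strongRing) : Associated G H ↔ G = H ∨ G = -H := by
  constructor
  · rintro ⟨u, rfl⟩
    rcases (strongRing_isUnit_iff _).1 u.isUnit with h | h <;> simp [h]
  · rintro (rfl | rfl)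
    · exact Associated.refl _
    · exact (Associated.refl H).neg_left

instance : UniqueFactorizationMonoid strongRing :=
  strongRingEquiv.toMulEquiv.uniqueFactorizationMonoid inferInstance

/-- A nonconstant monomial is divisible by some variable; irreducibility makes the cofactor a unit,
and a unit that is a monomial with coefficient 1 equals 1. -/
theorem exists_variable_of_irreducible {m : PrimeClass →₀ ℕ}
    (h : Irreducible (MvPolynomial.monomial m (1 : ℤ))) :
    ∃ i, MvPolynomial.monomial m (1 : ℤ) = MvPolynomial.X i := by
  classical
  have hm : m ≠ 0 := by
    rintro rfl
    exact h.not_isUnit isUnit_one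
  obtain ⟨i, hi⟩ := Finsupp.ne_iff.1 hm
  have hle : Finsupp.single i 1 ≤ m := by
    rw [Finsupp.single_le_iff]
    exact Nat.one_le_iff_ne_zero.2 hi
  have hmul : MvPolynomial.monomial m (1 : ℤ) =
      MvPolynomial.X i * MvPolynomial.monomial (m - Finsupp.single i 1) 1 := by
    rw [MvPolynomial.X, MvPolynomial.monomial_mul, add_tsub_cancel_of_le hle, one_mul]
  refine ⟨i, ?_⟩
  obtain ⟨r, hr, hC⟩ := MvPolynomial.isUnit_iff_eq_C_of_isReduced.1
    ((h.isUnit_or_isUnit hmul).resolve_left MvPolynomial.X_prime.not_isUnit)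
  rw [MvPolynomial.C_apply, MvPolynomial.monomial_eq_monomial_iff] at hC
  rcases hC with ⟨h0, rfl⟩ | ⟨h0, -⟩
  · rw [hmul, h0, MvPolynomial.monomial_zero', map_one, mul_one]
  · exact absurd h0 one_ne_zero

theorem isUnsignedAdditivePrime_and_irreducible_iff (G : strongRing) :
    IsUnsignedAdditivePrime G ∧ Irreducible G ↔
      ∃ (V : Type) (_ : Finite V) (K : AbstractSimplicialComplex V),
        (connectionGraph K).Connected ∧ Nontrivial V ∧ G = complexClass K := by
  rw [← exists_variable_iff]
  obtain ⟨f, rfl⟩ := strongRingEquiv.surjective G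
  rw [isUnsignedAdditivePrime_iff, MulEquiv.irreducible_iff]
  simp only [strongRingEquiv.injective.eq_iff]
  constructor
  · rintro ⟨⟨m, rfl⟩, h⟩
    exact exists_variable_of_irreducible h
  · rintro ⟨i, rfl⟩
    exact ⟨⟨Finsupp.single i 1, rfl⟩, MvPolynomial.X_prime.irreducible⟩

theorem mainTheorem6 :
    (∀ G : strongRing, IsAdditivePrime G →
      (∃ s : Multiset strongRing,
        (∀ P ∈ s, IsMultiplicativePrime P) ∧ (G = s.prod ∨ G = -s.prod)) ∧
      ∀ s t : Multiset strongRing,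
        (∀ P ∈ s, IsMultiplicativePrime P) → (G = s.prod ∨ G = -s.prod) →
        (∀ Q ∈ t, IsMultiplicativePrime Q) → (G = t.prod ∨ G = -t.prod) →
        Multiset.Rel (fun P Q => P = Q ∨ P = -Q) s t) ∧
    ∀ G : strongRing,
      (IsAdditivePrime G ∧ IsMultiplicativePrime G) ↔
        ∃ (V : Type) (_ : Finite V) (K : AbstractSimplicialComplex V),
          (connectionGraph K).Connected ∧ Nontrivial V ∧
            (G = complexClass K ∨ G = -complexClass K) := by
  simp only [isMultiplicativePrime_iff, ← strongRing_associated_iff]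
  refine ⟨fun G hG => ⟨?_, fun s t hs hGs ht hGt => ?_⟩, fun G => ?_⟩
  · have hG0 : G ≠ 0 := by
      rcases hG with h | h
      · exact h.2.1
      · exact neg_ne_zero.1 h.2.1
    obtain ⟨s, hs, h⟩ := UniqueFactorizationMonoid.exists_prime_factors G hG0
    exact ⟨s, fun P hP => UniqueFactorizationMonoid.irreducible_iff_prime.2 (hs P hP), h.symm⟩
  · exact UniqueFactorizationMonoid.factors_unique hs ht (hGs.symm.trans hGt)
  -- Irreducibility ignores the sign, so each alternative of `IsAdditivePrime` reduces to the
  -- unsigned case for `G` or `-G`.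
  · have hneg : Irreducible G ↔ Irreducible (-G) :=
      ((strongRing_associated_iff G (-G)).2 (Or.inr (neg_neg G).symm)).irreducible_iff
    rw [IsAdditivePrime, or_and_right, isUnsignedAdditivePrime_and_irreducible_iff, hneg,
      isUnsignedAdditivePrime_and_irreducible_iff]
    simp only [strongRing_associated_iff, neg_eq_iff_eq_neg]
    constructor
    · rintro (⟨V, hV, K, h1, h2, h3⟩ | ⟨V, hV, K, h1, h2, h3⟩)
      · exact ⟨V, hV, K, h1, h2, Or.inl h3⟩
      · exact ⟨V, hV, K, h1, h2, Or.inr h3⟩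
    · rintro ⟨V, hV, K, h1, h2, h3 | h3⟩
      · exact Or.inl ⟨V, hV, K, h1, h2, h3⟩
      · exact Or.inr ⟨V, hV, K, h1, h2, h3⟩
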